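/- Let $[n]=\{1,\dots,n\}$. A set partition of $[n]$ is a collection of pairwise disjoint nonempty subsets (blocks) of $[n]$ with union $[n]$. A family $\mathcal{A}$ of set partitions of $[n]$ is $t$-intersecting if $|P\cap Q|\ge t$ for all $P,Q\in\mathcal{A}$, i.e. any two members have at least $t$ blocks in common; it is trivially $t$-intersecting if there are $t$ distinct elements $x_1,\dots,x_t\in[n]$ such that $\{x_1\},\dots,\{x_t\}$ are blocks of every member of $\mathcal{A}$; and it is non-trivially $t$-intersecting (or a non-trivial $t$-intersecting family) if it is $t$-intersecting but not trivially so. For distinct $i,j\in[n]$ and a set partition $P$ of $[n]$, let $P_{[i]}$ be the block of $P$ containing $i$, and put $$s_{ij}(P)=\begin{cases}\bigl(P\setminus\{P_{[i]}\}\bigr)\cup\{\{i\},\,P_{[i]}\setminus\{i\}\} & \text{if } j\in P_{[i]},\\ P & \text{otherwise.}\end{cases}$$ For a family $\mathcal{A}$ let $\mathcal{A}_{ij}=\{P\in\mathcal{A}: s_{ij}(P)\notin\mathcal{A}\}$ and $S_{ij}(\mathcal{A})=(\mathcal{A}\setminus\mathcal{A}_{ij})\cup\{s_{ij}(P):P\in\mathcal{A}_{ij}\}$.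 The family $\mathcal{A}$ is compressed if $S_{ij}(\mathcal{A})=\mathcal{A}$ for all distinct $i,j\in[n]$. Theorem 3.6. For every integer $t\ge 1$ there is $n_0(t)$ such that for all $n\ge n_0(t)$ the following holds. Let $\mathcal{A}$ be a non-trivial $t$-intersecting family of set partitions of $[n]$ that has maximum size among all non-trivial $t$-intersecting families of set partitions of $[n]$. If $\mathcal{A}$ is not compressed, then there exist distinct $k,l\in[n]$ such that $S_{kl}(\mathcal{A})\ne\mathcal{A}$ and $S_{kl}(\mathcal{A})$ is non-trivially $t$-intersecting. -/

import Mathlib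

/-- Set partitions of an `n`-element ground set (`Fin n` plays the role of `{1, …, n}`); the blocks
of `P` are the elements of `P.parts`. -/
abbrev SetPartition (n : ℕ) : Type := Finpartition (Finset.univ : Finset (Fin n))

namespace SetPartition

variable {n : ℕ}

/-- If `j ≠ i` lies in the block of `i`, replace that block `B` by the two blocks `{i}` and
`B \ {i}`. -/
def splitBlock (i j : Fin n) (P : SetPartition n) (hij : i ≠ j) (hj : j ∈ P.part i) :
    SetPartition n :=
  Finpartition.ofExistsUnique
    (P.parts \ {P.part i} ∪ {{i}, P.part i \ {i}})
    (fun p _ => Finset.subset_univ p)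
    (by
      intro a _
      have ha : a ∈ P.part a := P.mem_part_self.2 (Finset.mem_univ a)
      have hi : i ∈ P.part i := P.mem_part_self.2 (Finset.mem_univ i)
      have hPa : P.part a ∈ P.parts := P.part_mem.2 (Finset.mem_univ a)
      have hPi : P.part i ∈ P.parts := P.part_mem.2 (Finset.mem_univ i)
      have key : ∀ t ∈ P.parts, a ∈ t → t = P.part a :=
        fun t ht hat => (P.part_eq_of_mem ht hat).symm
      have keyi : a ∈ P.part i → P.part i = P.part a := key _ hPi
      simp only [Finset.mem_union, Finset.mem_sdiff, Finset.mem_insert, Finset.mem_singleton]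
      by_cases hai : a = i
      · subst hai
        refine ⟨{a}, ⟨Or.inr (Or.inl rfl), by simp⟩, ?_⟩
        rintro t ⟨⟨ht, hne⟩ | rfl | rfl, hat⟩
        · exact absurd (key t ht hat) hne
        · rfl
        · simp at hat
      · by_cases hap : a ∈ P.part i
        · refine ⟨P.part i \ {i}, ⟨Or.inr (Or.inr rfl), by simp [hap, hai]⟩, ?_⟩
          rintro t ⟨⟨ht, hne⟩ | rfl | rfl, hat⟩
          · exact absurd ((key t ht hat).trans (keyi hap).symm) hne
          · exact absurd (Finset.mem_singleton.1 hat) hai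
          · rfl
        · refine ⟨P.part a, ⟨Or.inl ⟨hPa, fun h => hap (h ▸ ha)⟩, ha⟩, ?_⟩
          rintro t ⟨⟨ht, hne⟩ | rfl | rfl, hat⟩
          · exact key t ht hat
          · exact absurd (Finset.mem_singleton.1 hat) hai
          · exact absurd (Finset.mem_sdiff.1 hat).1 hap)
    (by
      simp only [Finset.mem_union, Finset.mem_sdiff, Finset.mem_insert, Finset.mem_singleton]
      rintro (⟨h, -⟩ | h | h)
      · exact P.empty_notMem_parts h
      · exact Finset.singleton_ne_empty i h.symm
      · have : j ∈ P.part i \ {i} := by simp [hj, hij.symm]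
        rw [← h] at this
        simp at this)

/-- The `(i,j)`-split `s_{ij}(P)`. It is only used for `i ≠ j`; for `i = j` it returns `P`. -/
def split (i j : Fin n) (P : SetPartition n) : SetPartition n :=
  if h : i ≠ j ∧ j ∈ P.part i then splitBlock i j P h.1 h.2 else P

/-- `𝒜_{ij}`: the members of `𝒜` whose `(i,j)`-split is not in `𝒜`. -/
def movable (i j : Fin n) (𝒜 : Finset (SetPartition n)) : Finset (SetPartition n) :=
  𝒜.filter fun P => split i j P ∉ 𝒜

/-- The `(i,j)`-splitting `S_{ij}(𝒜) = (𝒜 \ 𝒜_{ij}) ∪ s_{ij}(𝒜_{ij})`. -/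
def splitting (i j : Fin n) (𝒜 : Finset (SetPartition n)) : Finset (SetPartition n) :=
  (𝒜 \ movable i j 𝒜) ∪ (movable i j 𝒜).image (split i j)

/-- Compressed: fixed by all splitting operations. -/
def IsCompressed (𝒜 : Finset (SetPartition n)) : Prop :=
  ∀ i j : Fin n, i ≠ j → splitting i j 𝒜 = 𝒜

/-- `t`-intersecting: any two members have at least `t` blocks in common. -/
def IsIntersecting (t : ℕ) (𝒜 : Finset (SetPartition n)) : Prop :=
  ∀ P ∈ 𝒜, ∀ Q ∈ 𝒜, t ≤ (P.parts ∩ Q.parts).card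

/-- Trivial: there are `t` fixed singletons that are blocks of all members. -/
def IsTrivial (t : ℕ) (𝒜 : Finset (SetPartition n)) : Prop :=
  ∃ T : Finset (Fin n), T.card = t ∧ ∀ P ∈ 𝒜, ∀ x ∈ T, {x} ∈ P.parts

/-- Non-trivial `t`-intersecting families. -/
def IsNontrivialIntersecting (t : ℕ) (𝒜 : Finset (SetPartition n)) : Prop :=
  IsIntersecting t 𝒜 ∧ ¬ IsTrivial t 𝒜

/-- Non-trivial `t`-intersecting families of maximum size among all such families of set
partitions of the same ground set. -/
def IsMaxNontrivialIntersecting (t : ℕ) (𝒜 : Finset (SetPartition n)) : Prop :=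
  IsNontrivialIntersecting t 𝒜 ∧
    ∀ ℬ : Finset (SetPartition n), IsNontrivialIntersecting t ℬ → ℬ.card ≤ 𝒜.card

end SetPartition

/-!
Suppose that every splitting which changes `𝒜` makes it trivial, and let `S_{ij}` be such a
splitting, with `T` a set of `t` singletons common to all members of `S_{ij}(𝒜)`.

The partitions containing all but at most one of `t + 2` given singletons form a non-trivial
`t`-intersecting family, which for large `n` is more than twice as large as the family of all
partitions containing `t + 1` given singletons; by maximality so is `𝒜`. If `k ∉ T ∪ {i, j}` and
`S_{kl}` changed `𝒜`, then `S_{kl}(𝒜)` would have `t` common singletons `X ≠ T`, and each of its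
members would contain the singletons of `T` or have `i` and `j` in one block. Both kinds are at most
as numerous as the partitions with `t + 1` given singletons, so `𝒜` would be too small.

Hence `𝒜` is invariant under all splittings of elements outside `T ∪ {i, j}`. Consequently two
members always share `t` blocks each of which is either a singleton or equal to `{i, j}`. The finest
partition is not in `𝒜`, so maximality provides a member with fewer than `t` singletons.
This forces `{i, j}` to be a block of every member along with the same `t - 1` singletons, and
splitting `{i, j}` shows again that `𝒜` is too small.
-/

namespace SetPartition

open Finset

section Partition

variable {α : Type*} [Fintype α] [DecidableEq α] {P Q : Finpartition (univ : Finset α)} {x y : α}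

theorem self_mem_part (P : Finpartition (univ : Finset α)) (x : α) : x ∈ P.part x :=
  P.mem_part_self.2 (mem_univ x)

theorem part_mem_parts (P : Finpartition (univ : Finset α)) (x : α) : P.part x ∈ P.parts :=
  P.part_mem.2 (mem_univ x)

theorem part_eq_part_iff : P.part x = P.part y ↔ y ∈ P.part x := by
  rw [P.mem_part_iff_part_eq_part (mem_univ y) (mem_univ x), eq_comm]

theorem mem_part_comm : y ∈ P.part x ↔ x ∈ P.part y := by
  rw [← part_eq_part_iff, ← part_eq_part_iff, eq_comm]

theorem ext_of_mem_part (h : ∀ x y, y ∈ P.part x ↔ y ∈ Q.part x) : P = Q := by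
  have parts_subset {P Q : Finpartition (univ : Finset α)}
      (h : ∀ x y, y ∈ P.part x ↔ y ∈ Q.part x) : P.parts ⊆ Q.parts := by
    intro C hC
    obtain ⟨x, hx⟩ := P.nonempty_of_mem_parts hC
    rw [← P.part_eq_of_mem hC hx, Finset.ext (h x)]
    exact part_mem_parts Q x
  exact Finpartition.ext
    (Subset.antisymm (parts_subset h) (parts_subset fun x y => (h x y).symm))

/-- The elements that form a block on their own. -/
def singletons (P : Finpartition (univ : Finset α)) : Finset α :=
  univ.filter fun x => {x} ∈ P.parts

theorem mem_singletons : x ∈ singletons P ↔ {x} ∈ P.parts := by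
  simp [singletons]

theorem mem_singletons_iff_part_eq : x ∈ singletons P ↔ P.part x = {x} := by
  rw [mem_singletons]
  exact ⟨fun h => P.part_eq_of_mem h (mem_singleton_self x), fun h => h ▸ part_mem_parts P x⟩

theorem mem_singletons_iff_forall : x ∈ singletons P ↔ ∀ y ∈ P.part x, y = x := by
  rw [mem_singletons_iff_part_eq, eq_singleton_iff_unique_mem, and_iff_right (self_mem_part P x)]

theorem notMem_singletons (hxy : x ≠ y) (h : y ∈ P.part x) : x ∉ singletons P :=
  fun hx => hxy.symm (mem_singletons_iff_forall.1 hx y h)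

theorem card_le_card_inter_parts {V : Finset α} (hP : V ⊆ singletons P) (hQ : V ⊆ singletons Q) :
    #V ≤ #(P.parts ∩ Q.parts) :=
  card_le_card_of_injOn singleton
    (fun _ hx => mem_inter.2 ⟨mem_singletons.1 (hP hx), mem_singletons.1 (hQ hx)⟩)
    singleton_injective.injOn

theorem eq_bot_iff_singletons : P = ⊥ ↔ singletons P = univ := by
  have singletons_bot : singletons (⊥ : Finpartition (univ : Finset α)) = univ :=
    eq_univ_of_forall fun x => mem_singletons.2 (Finpartition.mem_bot_iff.2 ⟨x, mem_univ x, rfl⟩)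
  refine ⟨fun h => h ▸ singletons_bot, fun h => ext_of_mem_part fun x y => ?_⟩
  rw [mem_singletons_iff_part_eq.1 (eq_univ_iff_forall.1 h x),
    mem_singletons_iff_part_eq.1 (eq_univ_iff_forall.1 singletons_bot x)]

theorem eq_bot_of_compl_pair_subset_singletons (h : {x, y}ᶜ ⊆ singletons P)
    (hxy : y ∉ P.part x) : P = ⊥ := by
  have mem_singletons_left {a b : α} (h : {a, b}ᶜ ⊆ singletons P) (hab : b ∉ P.part a) :
      a ∈ singletons P := by
    refine mem_singletons_iff_forall.2 fun z hz => by_contra fun hza => ?_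
    have hzb : z ≠ b := ne_of_mem_of_not_mem hz hab
    exact notMem_singletons hza (mem_part_comm.1 hz) (h (by simp [hza, hzb]))
  refine eq_bot_iff_singletons.2 (eq_univ_of_forall fun z => ?_)
  by_cases hz : z ∈ ({x, y} : Finset α)
  · rcases mem_insert.1 hz with rfl | hz
    · exact mem_singletons_left h hxy
    · rw [mem_singleton.1 hz]
      exact mem_singletons_left (pair_comm x y ▸ h) (mem_part_comm.not.1 hxy)
  · exact h (mem_compl.2 hz)

open Classical in
/-- The partition of `α` into the nonempty fibres of `g`. -/
noncomputable def ofFun {β : Type*} (g : α → β) : Finpartition (univ : Finset α) :=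
  Finpartition.ofSetoid (Setoid.ker g)

theorem mem_part_ofFun {β : Type*} {g : α → β} : y ∈ (ofFun g).part x ↔ g x = g y := by
  classical
  rw [ofFun, Finpartition.mem_part_ofSetoid_iff_rel, Setoid.ker_def]

/-- The preimage of a partition under `f`, as a partition of the domain of `f`. -/
noncomputable def comap {β : Type*} [Fintype β] [DecidableEq β] (f : α → β)
    (P : Finpartition (univ : Finset β)) : Finpartition (univ : Finset α) :=
  ofFun fun x => P.part (f x)

theorem mem_part_comap {β : Type*} [Fintype β] [DecidableEq β] {f : α → β}
    {P : Finpartition (univ : Finset β)} : y ∈ (comap f P).part x ↔ f y ∈ P.part (f x) := by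
  rw [comap, mem_part_ofFun, part_eq_part_iff]

theorem comap_injective {β : Type*} [Fintype β] [DecidableEq β] {f : α → β}
    (hf : Function.Surjective f) : Function.Injective (comap f) := by
  refine fun P Q h => ext_of_mem_part fun x y => ?_
  obtain ⟨a, rfl⟩ := hf x
  obtain ⟨b, rfl⟩ := hf y
  rw [← mem_part_comap, h, mem_part_comap]

/-- The partition obtained from `P` by making every element of `X` a block on its own, as repeated
splittings do. -/
noncomputable def isolate (X : Finset α) (P : Finpartition (univ : Finset α)) :
    Finpartition (univ : Finset α) :=
  ofFun fun x => if x ∈ X then {x} else P.part x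

theorem mem_part_isolate {X : Finset α} :
    y ∈ (isolate X P).part x ↔ y = x ∨ x ∉ X ∧ y ∉ X ∧ y ∈ P.part x := by
  have singleton_ne_part {a b : α} (ha : a ∈ X) (hb : b ∉ X) : {a} ≠ P.part b := fun h =>
    hb (mem_singleton.1 (h ▸ self_mem_part P b) ▸ ha)
  rw [isolate, mem_part_ofFun]
  split_ifs with hx hy hy
  · simp [hx, eq_comm]
  · simp [hx, singleton_ne_part hx hy, (ne_of_mem_of_not_mem hx hy).symm]
  · simp [hy, (singleton_ne_part hy hx).symm, ne_of_mem_of_not_mem hy hx]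
  · simp only [part_eq_part_iff, hx, hy, not_false_eq_true, true_and]
    exact (or_iff_right_of_imp fun h => h ▸ self_mem_part P x).symm

theorem union_singletons_subset_singletons_isolate (X : Finset α) :
    X ∪ singletons P ⊆ singletons (isolate X P) := by
  intro x hx
  refine mem_singletons_iff_forall.2 fun y hy => (mem_part_isolate.1 hy).elim id fun h => ?_
  exact mem_singletons_iff_forall.1 ((mem_union.1 hx).resolve_left h.1) y h.2.2

theorem isolate_isolate (X Y : Finset α) : isolate X (isolate Y P) = isolate (X ∪ Y) P := by
  refine ext_of_mem_part fun x y => ?_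
  simp only [mem_part_isolate, mem_union]
  tauto

theorem isolate_eq_self {X : Finset α} (hX : X ⊆ singletons P) : isolate X P = P := by
  refine ext_of_mem_part fun x y => mem_part_isolate.trans ⟨?_, fun h => ?_⟩
  · rintro (rfl | h)
    exacts [self_mem_part P y, h.2.2]
  · refine or_iff_not_imp_left.2 fun hyx => ⟨fun hx => ?_, fun hy => ?_, h⟩
    · exact notMem_singletons (Ne.symm hyx) h (hX hx)
    · exact notMem_singletons hyx (mem_part_comm.1 h) (hX hy)

/-- The partition with block `B` all of whose other blocks are singletons. -/
noncomputable def oneBlock (B : Finset α) : Finpartition (univ : Finset α) :=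
  isolate Bᶜ (ofFun fun _ => ())

theorem mem_part_oneBlock {B : Finset α} :
    y ∈ (oneBlock B).part x ↔ y = x ∨ x ∈ B ∧ y ∈ B := by
  simp [oneBlock, mem_part_isolate, mem_part_ofFun]

theorem singletons_oneBlock {B : Finset α} (hB : 1 < #B) : singletons (oneBlock B) = Bᶜ := by
  ext x
  rw [mem_compl]
  refine ⟨fun hx hxB => ?_, fun hx => mem_singletons_iff_forall.2 fun y hy => ?_⟩
  · obtain ⟨y, hy, hyx⟩ := exists_mem_ne hB x
    exact notMem_singletons hyx.symm (mem_part_oneBlock.2 (.inr ⟨hxB, hy⟩)) hx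
  · exact (mem_part_oneBlock.1 hy).resolve_right fun h => hx h.1

/-- The partition obtained from `P` by moving `i` to the block of `j`. This inverts `isolate {i}` on
the partitions in which `i` and `j` share a block. -/
noncomputable def moveTo (i j : α) (P : Finpartition (univ : Finset α)) :
    Finpartition (univ : Finset α) :=
  comap (Function.update id i j) P

theorem mem_part_moveTo_of_ne {i j : α} (hx : x ≠ i) (hy : y ≠ i) :
    y ∈ (moveTo i j P).part x ↔ y ∈ P.part x := by
  rw [moveTo, mem_part_comap, Function.update_of_ne hx, Function.update_of_ne hy, id, id]

theorem mem_part_moveTo_self {i j : α} (hij : i ≠ j) : j ∈ (moveTo i j P).part i := by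
  rw [moveTo, mem_part_comap, Function.update_self, Function.update_of_ne hij.symm]
  exact self_mem_part P j

theorem moveTo_isolate {i j : α} (hij : i ≠ j) (h : j ∈ P.part i) :
    moveTo i j (isolate {i} P) = P := by
  have update_ne (x : α) : Function.update id i j x ≠ i := by
    rcases eq_or_ne x i with rfl | hx
    · simpa using hij.symm
    · simp [hx]
  have part_update (x : α) : P.part (Function.update id i j x) = P.part x := by
    rcases eq_or_ne x i with rfl | hx
    · simpa using (part_eq_part_iff.2 h).symm
    · simp [hx]
  refine ext_of_mem_part fun x y => ?_
  rw [moveTo, mem_part_comap, mem_part_isolate, ← part_eq_part_iff, part_update, part_update,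
    part_eq_part_iff]
  simp only [mem_singleton, update_ne, not_false_eq_true, true_and, or_iff_right_iff_imp]
  intro hxy
  rw [← part_eq_part_iff, ← part_update, ← hxy, part_update]

theorem isolate_moveTo {i j : α} (hi : i ∈ singletons P) :
    isolate {i} (moveTo i j P) = P := by
  refine ext_of_mem_part fun x y => ?_
  rw [mem_part_isolate, mem_singleton, mem_singleton]
  rcases eq_or_ne x i with rfl | hx
  · simp [mem_singletons_iff_part_eq.1 hi]
  rcases eq_or_ne y i with rfl | hy
  · simp [mem_part_comm (x := x), mem_singletons_iff_part_eq.1 hi, hx, hx.symm]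
  · rw [mem_part_moveTo_of_ne hx hy]
    simp only [hx, hy, not_false_eq_true, true_and, or_iff_right_iff_imp]
    exact fun hyx => hyx ▸ self_mem_part P y

theorem isolate_injOn {i j : α} (hij : i ≠ j) :
    Set.InjOn (isolate {i}) {P : Finpartition (univ : Finset α) | j ∈ P.part i} :=
  Set.LeftInvOn.injOn fun _ => moveTo_isolate hij

/-- The partitions in which every element of `W` is a block on its own; a family is trivial if it is
contained in `fixing T` for some `T` of size `t`. -/
def fixing (W : Finset α) : Finset (Finpartition (univ : Finset α)) :=
  univ.filter fun P => W ⊆ singletons P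

theorem mem_fixing {W : Finset α} : P ∈ fixing W ↔ W ⊆ singletons P := by
  simp [fixing]

theorem fixing_anti {V W : Finset α} (h : V ⊆ W) : fixing W ⊆ fixing V :=
  fun _ hP => mem_fixing.2 (h.trans (mem_fixing.1 hP))

theorem mem_fixing_union {V W : Finset α} : P ∈ fixing (V ∪ W) ↔ P ∈ fixing V ∧ P ∈ fixing W := by
  simp only [mem_fixing, union_subset_iff]

theorem comap_mem_fixing {V W : Finset α} {σ : Equiv.Perm α} (hσ : ∀ x ∈ W, σ x ∈ V)
    (hP : P ∈ fixing V) : comap σ P ∈ fixing W := by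
  refine mem_fixing.2 fun x hx => mem_singletons_iff_forall.2 fun y hy => σ.injective ?_
  exact mem_singletons_iff_forall.1 (mem_fixing.1 hP (hσ x hx)) _ (mem_part_comap.1 hy)

theorem card_fixing_le_of_card_le {V W : Finset α} (h : #W ≤ #V) : #(fixing V) ≤ #(fixing W) := by
  obtain ⟨V', hV', hcard⟩ := exists_subset_card_eq h
  let σ : Equiv.Perm α := (equivOfCardEq hcard.symm).extendSubtype
  have hσ : ∀ x ∈ W, σ x ∈ V := fun x hx => hV' (Equiv.extendSubtype_mem _ x hx)
  exact card_le_card_of_injOn (comap σ) (fun P hP => comap_mem_fixing hσ hP)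
    (comap_injective σ.surjective).injOn

theorem card_fixing_eq_of_card_eq {V W : Finset α} (h : #V = #W) : #(fixing V) = #(fixing W) :=
  (card_fixing_le_of_card_le h.ge).antisymm (card_fixing_le_of_card_le h.le)

theorem moveTo_mem_fixing {W : Finset α} {i j : α} (hi : i ∉ W) (hj : j ∉ W)
    (hP : P ∈ fixing W) : moveTo i j P ∈ fixing W := by
  refine mem_fixing.2 fun x hx => mem_singletons_iff_forall.2 fun y hy => ?_
  have hxP := mem_fixing.1 hP hx
  have hxi : x ≠ i := ne_of_mem_of_not_mem hx hi
  rw [moveTo, mem_part_comap, Function.update_of_ne hxi, id] at hy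
  have hyx := mem_singletons_iff_forall.1 hxP _ hy
  rcases eq_or_ne y i with rfl | hyi
  · rw [Function.update_self] at hyx
    exact absurd (hyx ▸ hx) hj
  · rwa [Function.update_of_ne hyi] at hyx

theorem card_fixing_insert_le_card_filter {W : Finset α} {i j : α} (hi : i ∉ W) (hj : j ∉ W)
    (hij : i ≠ j) : #(fixing (insert i W)) ≤ #{P ∈ fixing W | j ∈ P.part i} := by
  refine card_le_card_of_injOn (moveTo i j) (fun P hP => mem_filter.2 ⟨?_, ?_⟩) ?_
  · exact moveTo_mem_fixing hi hj (fixing_anti (subset_insert i W) hP)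
  · exact mem_part_moveTo_self hij
  · exact Set.LeftInvOn.injOn (f₁' := isolate {i}) fun P hP =>
      isolate_moveTo (mem_fixing.1 hP (mem_insert_self i W))

theorem two_mul_card_fixing_insert_lt {W : Finset α} {i : α} (hi : i ∉ W)
    (hW : #W + 3 ≤ Fintype.card α) : 2 * #(fixing (insert i W)) < #(fixing W) := by
  obtain ⟨j, k, hj, hk, hjk⟩ : ∃ j k, j ∈ (insert i W)ᶜ ∧ k ∈ (insert i W)ᶜ ∧ j ≠ k := by
    refine one_lt_card_iff.1 ?_
    rw [card_compl, card_insert_of_notMem hi]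
    omega
  simp only [mem_compl, mem_insert, not_or, ← ne_eq] at hj hk
  set isolated := fixing (insert i W)
  set joined := {P ∈ fixing W | j ∈ P.part i}
  have isolated_subset : isolated ⊆ fixing W := fixing_anti (subset_insert i W)
  have disjoint_joined : Disjoint isolated joined := disjoint_left.2 fun P hP hPj =>
    notMem_singletons hj.1.symm (mem_filter.1 hPj).2 (mem_fixing.1 hP (mem_insert_self i W))
  -- `{i, k}` is a block of neither an isolated nor a joined partition, so the inequality is strict.
  have singletons_eq : singletons (oneBlock {i, k}) = {i, k}ᶜ :=
    singletons_oneBlock (card_pair hk.1.symm ▸ one_lt_two)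
  have oneBlock_mem : oneBlock {i, k} ∈ fixing W := by
    rw [mem_fixing, singletons_eq, subset_compl_comm]
    simp [insert_subset_iff, hi, hk.2]
  have oneBlock_notMem : oneBlock {i, k} ∉ isolated ∪ joined := by
    refine notMem_union.2 ⟨fun h => ?_, fun h => ?_⟩
    · simpa [singletons_eq] using mem_fixing.1 h (mem_insert_self i W)
    · simpa [mem_part_oneBlock, hj.1, hjk] using (mem_filter.1 h).2
  have hss : isolated ∪ joined ⊂ fixing W :=
    (ssubset_iff_of_subset (union_subset isolated_subset (filter_subset _ _))).2
      ⟨_, oneBlock_mem, oneBlock_notMem⟩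
  have hlt := card_lt_card hss
  have hle : #isolated ≤ #joined := card_fixing_insert_le_card_filter hi hj.2 hj.1.symm
  rw [card_union_of_disjoint disjoint_joined] at hlt
  omega

/-- The partitions in which all elements of `S`, with at most one exception, are blocks on their
own. For `#S = t + 2` this is the non-trivial `t`-intersecting family that bounds the maximum size
from below. -/
def nearlyFixing (S : Finset α) : Finset (Finpartition (univ : Finset α)) :=
  S.biUnion fun s => fixing (S.erase s)

theorem mem_nearlyFixing {S : Finset α} : P ∈ nearlyFixing S ↔ ∃ s ∈ S, P ∈ fixing (S.erase s) :=
  mem_biUnion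

theorem card_fixing_add_sum_le_card_nearlyFixing {S : Finset α} (hS : S.Nonempty) :
    #(fixing S) + ∑ s ∈ S, #(fixing (S.erase s) \ fixing S) ≤ #(nearlyFixing S) := by
  have hdisj : Set.PairwiseDisjoint ↑S fun s => fixing (S.erase s) \ fixing S := by
    refine fun s _ r _ hsr => disjoint_left.2 fun P hPs hPr => (mem_sdiff.1 hPs).2 ?_
    rw [mem_sdiff, mem_fixing] at hPs hPr
    refine mem_fixing.2 fun x hx => ?_
    rcases eq_or_ne x s with rfl | hxs
    exacts [hPr.1 (mem_erase.2 ⟨hsr, hx⟩), hPs.1 (mem_erase.2 ⟨hxs, hx⟩)]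
  have hdisj' : Disjoint (fixing S) (S.biUnion fun s => fixing (S.erase s) \ fixing S) :=
    (disjoint_biUnion_right _ _ _).2 fun _ _ => disjoint_sdiff
  rw [← card_biUnion hdisj, ← card_union_of_disjoint hdisj']
  obtain ⟨s, hs⟩ := hS
  refine card_le_card (union_subset (fun P hP => ?_) (biUnion_mono fun _ _ => sdiff_subset))
  exact mem_nearlyFixing.2 ⟨s, hs, fixing_anti (erase_subset s S) hP⟩

theorem two_mul_card_fixing_lt_card_nearlyFixing {S W : Finset α} (hS : 3 ≤ #S)
    (hSW : #S ≤ #W + 1) (hα : #S + 2 ≤ Fintype.card α) : 2 * #(fixing W) < #(nearlyFixing S) := by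
  obtain ⟨s₀, hs₀⟩ : S.Nonempty := card_pos.1 (by omega)
  set a := #(fixing (S.erase s₀))
  have card_erase (s : α) (hs : s ∈ S) : #(fixing (S.erase s)) = a :=
    card_fixing_eq_of_card_eq (by rw [card_erase_of_mem hs, card_erase_of_mem hs₀])
  have hlt : 2 * #(fixing S) < a := by
    have := card_erase_of_mem hs₀
    simpa only [insert_erase hs₀] using
      two_mul_card_fixing_insert_lt (notMem_erase s₀ S) (by omega)
  have hW : #(fixing W) ≤ a :=
    card_fixing_le_of_card_le (by rw [card_erase_of_mem hs₀]; omega)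
  have hsum : ∑ s ∈ S, #(fixing (S.erase s) \ fixing S) = #S * (a - #(fixing S)) := by
    refine sum_const_nat fun s hs => ?_
    rw [card_sdiff_of_subset (fixing_anti (erase_subset s S)), card_erase s hs]
  have hle := card_fixing_add_sum_le_card_nearlyFixing ⟨s₀, hs₀⟩
  have hmul : 3 * (a - #(fixing S)) ≤ #S * (a - #(fixing S)) := Nat.mul_le_mul_right _ hS
  omega

end Partition

section Splitting

variable {n t : ℕ} {i j k l : Fin n} {T W X : Finset (Fin n)} {P Q : SetPartition n}
  {𝒜 : Finset (SetPartition n)}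

theorem split_of_notMem (h : j ∉ P.part i) : split i j P = P :=
  dif_neg fun h' => h h'.2

theorem mem_parts_split (hij : i ≠ j) (h : j ∈ P.part i) {C : Finset (Fin n)} :
    C ∈ (split i j P).parts ↔ C ∈ P.parts ∧ C ≠ P.part i ∨ C = {i} ∨ C = P.part i \ {i} := by
  rw [split, dif_pos ⟨hij, h⟩]
  simp only [splitBlock, Finpartition.ofExistsUnique_parts, mem_union, mem_sdiff, mem_insert,
    mem_singleton]

theorem split_eq_isolate (hij : i ≠ j) (h : j ∈ P.part i) : split i j P = isolate {i} P := by
  refine ext_of_mem_part fun x y => ?_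
  rw [mem_part_isolate, mem_singleton, mem_singleton]
  rcases eq_or_ne x i with rfl | hxi
  · rw [Finpartition.part_eq_of_mem _ ((mem_parts_split hij h).2 (.inr (.inl rfl)))
      (mem_singleton_self x)]
    simp
  by_cases hx : x ∈ P.part i
  · rw [Finpartition.part_eq_of_mem _ ((mem_parts_split hij h).2 (.inr (.inr rfl)))
      (by simp [hx, hxi]), ← part_eq_part_iff.2 hx]
    simp only [mem_sdiff, mem_singleton]
    grind
  · have hne : P.part x ≠ P.part i := fun e => hx (e ▸ self_mem_part P x)
    rw [Finpartition.part_eq_of_mem _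
      ((mem_parts_split hij h).2 (.inl ⟨part_mem_parts P x, hne⟩)) (self_mem_part P x)]
    have hi : i ∉ P.part x := fun hi => hx (mem_part_comm.1 hi)
    have := self_mem_part P x
    grind

theorem split_injOn (hij : i ≠ j) : Set.InjOn (split i j) {P | j ∈ P.part i} :=
  (isolate_injOn hij).congr fun _ hP => (split_eq_isolate hij hP).symm

theorem singletons_subset_singletons_split (hij : i ≠ j) :
    singletons P ⊆ singletons (split i j P) := by
  by_cases h : j ∈ P.part i
  · rw [split_eq_isolate hij h]
    exact subset_union_right.trans (union_singletons_subset_singletons_isolate {i})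
  · rw [split_of_notMem h]

theorem mem_singletons_split_self (hij : i ≠ j) (h : j ∈ P.part i) :
    i ∈ singletons (split i j P) :=
  mem_singletons.2 ((mem_parts_split hij h).2 (.inr (.inl rfl)))

theorem singletons_split_subset (hij : i ≠ j) :
    singletons (split i j P) \ {i, j} ⊆ singletons P := by
  intro x hx
  simp only [mem_sdiff, mem_insert, mem_singleton, not_or] at hx
  obtain ⟨hx, hxi, hxj⟩ := hx
  by_cases h : j ∈ P.part i
  · rcases (mem_parts_split hij h).1 (mem_singletons.1 hx) with hC | hC | hC
    · exact mem_singletons.2 hC.1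
    · exact absurd (singleton_injective hC) hxi
    · have hj : j ∈ P.part i \ {i} := by simp [h, hij.symm]
      exact absurd (mem_singleton.1 (hC ▸ hj)).symm hxj
  · rwa [split_of_notMem h] at hx

theorem split_mem_fixing (hij : i ≠ j) (hP : P ∈ fixing W) : split i j P ∈ fixing W :=
  mem_fixing.2 ((mem_fixing.1 hP).trans (singletons_subset_singletons_split hij))

theorem mem_part_split (hki : k ≠ i) (hkj : k ≠ j) (hkl : k ≠ l) :
    j ∈ (split k l P).part i ↔ j ∈ P.part i := by
  by_cases h : l ∈ P.part k
  · rw [split_eq_isolate hkl h, mem_part_isolate]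
    simp only [mem_singleton, hki.symm, hkj.symm, not_false_eq_true, true_and,
      or_iff_right_iff_imp]
    rintro rfl
    exact self_mem_part P j
  · rw [split_of_notMem h]

theorem inter_subset_split_inter (hij : i ≠ j) (hP : j ∈ P.part i) (hQ : j ∉ Q.part i) :
    P.parts ∩ Q.parts ⊆ (split i j P).parts ∩ Q.parts := by
  intro C hC
  obtain ⟨hCP, hCQ⟩ := mem_inter.1 hC
  refine mem_inter.2 ⟨(mem_parts_split hij hP).2 (.inl ⟨hCP, ?_⟩), hCQ⟩
  rintro rfl
  exact hQ (Q.part_eq_of_mem hCQ (self_mem_part P i) ▸ hP)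

theorem inter_split_subset_split_inter (hij : i ≠ j) (hP : j ∈ P.part i) (hQ : j ∈ Q.part i) :
    P.parts ∩ (split i j Q).parts ⊆ (split i j P).parts ∩ Q.parts := by
  intro C hC
  obtain ⟨hCP, hCQ⟩ := mem_inter.1 hC
  rcases (mem_parts_split hij hQ).1 hCQ with ⟨hCQ, hne⟩ | rfl | rfl
  · refine mem_inter.2 ⟨(mem_parts_split hij hP).2 (.inl ⟨hCP, ?_⟩), hCQ⟩
    rintro rfl
    exact hne (Q.part_eq_of_mem hCQ (self_mem_part P i)).symm
  · exact absurd (mem_singletons.2 hCP) (notMem_singletons hij hP)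
  · have part_eq : P.part j = Q.part i \ {i} := P.part_eq_of_mem hCP (by simp [hQ, hij.symm])
    have hi : i ∈ P.part j := mem_part_comm.1 hP
    simp [part_eq] at hi

theorem card_inter_le_card_split_inter_split (hij : i ≠ j) (hP : j ∈ P.part i)
    (hQ : j ∈ Q.part i) :
    #(P.parts ∩ Q.parts) ≤ #((split i j P).parts ∩ (split i j Q).parts) := by
  have hsub : insert {i} ((P.parts ∩ Q.parts).erase (P.part i)) ⊆
      (split i j P).parts ∩ (split i j Q).parts := by
    refine insert_subset (mem_inter.2 ⟨?_, ?_⟩) fun C hC => ?_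
    · exact mem_singletons.1 (mem_singletons_split_self hij hP)
    · exact mem_singletons.1 (mem_singletons_split_self hij hQ)
    · obtain ⟨hne, hC⟩ := mem_erase.1 hC
      obtain ⟨hCP, hCQ⟩ := mem_inter.1 hC
      rw [mem_inter, mem_parts_split hij hP, mem_parts_split hij hQ]
      refine ⟨.inl ⟨hCP, hne⟩, .inl ⟨hCQ, ?_⟩⟩
      rintro rfl
      exact hne (P.part_eq_of_mem hCP (self_mem_part Q i)).symm
  have hi : {i} ∉ (P.parts ∩ Q.parts).erase (P.part i) := fun h =>
    notMem_singletons hij hP (mem_singletons.2 (mem_inter.1 (mem_of_mem_erase h)).1)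
  calc #(P.parts ∩ Q.parts) ≤ #((P.parts ∩ Q.parts).erase (P.part i)) + 1 :=
        Nat.le_add_of_sub_le pred_card_le_card_erase
    _ = #(insert {i} ((P.parts ∩ Q.parts).erase (P.part i))) := (card_insert_of_notMem hi).symm
    _ ≤ _ := card_le_card hsub

theorem split_inter_subset_erase {C : Finset (Fin n)} (hkl : k ≠ l) (hCP : C ∈ P.parts)
    (hCQ : C ∈ Q.parts) (hk : k ∈ C) (hl : l ∈ C) :
    (split k l P).parts ∩ Q.parts ⊆ (P.parts ∩ Q.parts).erase C := by
  intro D hD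
  obtain ⟨hDP, hDQ⟩ := mem_inter.1 hD
  rw [mem_parts_split hkl (P.part_eq_of_mem hCP hk ▸ hl), P.part_eq_of_mem hCP hk] at hDP
  rcases hDP with ⟨hDP, hne⟩ | rfl | rfl
  · exact mem_erase.2 ⟨hne, mem_inter.2 ⟨hDP, hDQ⟩⟩
  · exact absurd (mem_singletons.2 hDQ)
      (notMem_singletons hkl (Q.part_eq_of_mem hCQ hk ▸ hl))
  · have hlC : C \ {k} = C := Q.eq_of_mem_parts hDQ hCQ (by simp [hl, hkl.symm]) hl
    have hkC : k ∉ C \ {k} := by simp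
    exact absurd hk (hlC ▸ hkC)

theorem mem_movable : P ∈ movable i j 𝒜 ↔ P ∈ 𝒜 ∧ split i j P ∉ 𝒜 :=
  mem_filter

theorem mem_part_of_mem_movable (h : P ∈ movable i j 𝒜) : j ∈ P.part i := by
  by_contra hj
  rw [mem_movable, split_of_notMem hj] at h
  exact h.2 h.1

theorem mem_splitting :
    P ∈ splitting i j 𝒜 ↔ P ∈ 𝒜 ∧ split i j P ∈ 𝒜 ∨ ∃ Q ∈ movable i j 𝒜, split i j Q = P := by
  simp only [splitting, mem_union, mem_sdiff, mem_image, mem_movable]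
  tauto

theorem split_mem_splitting (hP : P ∈ movable i j 𝒜) : split i j P ∈ splitting i j 𝒜 :=
  mem_splitting.2 (.inr ⟨P, hP, rfl⟩)

theorem card_splitting (hij : i ≠ j) (𝒜 : Finset (SetPartition n)) :
    #(splitting i j 𝒜) = #𝒜 := by
  have hinj : Set.InjOn (split i j) (movable i j 𝒜) :=
    (split_injOn hij).mono fun _ => mem_part_of_mem_movable
  have hdisj : Disjoint (𝒜 \ movable i j 𝒜) ((movable i j 𝒜).image (split i j)) := by
    refine disjoint_right.2 fun P hP hP𝒜 => ?_
    obtain ⟨Q, hQ, rfl⟩ := mem_image.1 hP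
    exact (mem_movable.1 hQ).2 (mem_sdiff.1 hP𝒜).1
  rw [splitting, card_union_of_disjoint hdisj, card_image_of_injOn hinj]
  exact card_sdiff_add_card_eq_card (filter_subset _ _)

theorem splitting_ne_iff : splitting i j 𝒜 ≠ 𝒜 ↔ ∃ P, P ∈ movable i j 𝒜 := by
  refine ⟨fun h => ?_, fun ⟨P, hP⟩ h => (mem_movable.1 hP).2 (h ▸ split_mem_splitting hP)⟩
  by_contra! hm
  exact h (by simp [splitting, eq_empty_of_forall_notMem hm])

theorem isIntersecting_splitting (h𝒜 : IsIntersecting t 𝒜) (hij : i ≠ j) :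
    IsIntersecting t (splitting i j 𝒜) := by
  have movable_inter : ∀ P ∈ movable i j 𝒜, ∀ Q ∈ 𝒜, split i j Q ∈ 𝒜 →
      t ≤ #((split i j P).parts ∩ Q.parts) := by
    intro P hP Q hQ hQs
    have hj := mem_part_of_mem_movable hP
    have hP𝒜 := (mem_movable.1 hP).1
    by_cases hQj : j ∈ Q.part i
    · exact (h𝒜 P hP𝒜 _ hQs).trans (card_le_card (inter_split_subset_split_inter hij hj hQj))
    · exact (h𝒜 P hP𝒜 Q hQ).trans (card_le_card (inter_subset_split_inter hij hj hQj))
  intro P hP Q hQ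
  rcases mem_splitting.1 hP with ⟨hP𝒜, hPs⟩ | ⟨P', hP', rfl⟩ <;>
    rcases mem_splitting.1 hQ with ⟨hQ𝒜, hQs⟩ | ⟨Q', hQ', rfl⟩
  · exact h𝒜 P hP𝒜 Q hQ𝒜
  · exact inter_comm P.parts _ ▸ movable_inter Q' hQ' P hP𝒜 hPs
  · exact movable_inter P' hP' Q hQ𝒜 hQs
  · exact (h𝒜 P' (mem_movable.1 hP').1 Q' (mem_movable.1 hQ').1).trans
      (card_inter_le_card_split_inter_split hij (mem_part_of_mem_movable hP')
        (mem_part_of_mem_movable hQ'))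

theorem forall_mem_splitting {p : SetPartition n → Prop} (hp : ∀ P, p P → p (split i j P))
    (h : ∀ P ∈ 𝒜, p P) : ∀ P ∈ splitting i j 𝒜, p P := by
  intro P hP
  rcases mem_splitting.1 hP with ⟨hP, -⟩ | ⟨Q, hQ, rfl⟩
  exacts [h P hP, hp Q (h Q (mem_movable.1 hQ).1)]

theorem exists_mem_splitting {p : SetPartition n → Prop} (hp : ∀ P, p P → p (split i j P))
    (h : ∃ P ∈ 𝒜, p P) : ∃ P ∈ splitting i j 𝒜, p P := by
  obtain ⟨P, hP, hpP⟩ := h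
  by_cases hs : split i j P ∈ 𝒜
  · exact ⟨P, mem_splitting.2 (.inl ⟨hP, hs⟩), hpP⟩
  · exact ⟨_, split_mem_splitting (mem_movable.2 ⟨hP, hs⟩), hp P hpP⟩

theorem isTrivial_iff : IsTrivial t 𝒜 ↔ ∃ T, #T = t ∧ 𝒜 ⊆ fixing T := by
  simp only [IsTrivial, subset_iff, mem_fixing, mem_singletons]

/-- Compressed relative to `X`: fixed by every splitting operation that splits off an element of
`X`. -/
def IsCompressedOn (X : Finset (Fin n)) (𝒜 : Finset (SetPartition n)) : Prop :=
  ∀ k ∈ X, ∀ l, k ≠ l → splitting k l 𝒜 = 𝒜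

theorem IsCompressedOn.split_mem (hX : IsCompressedOn X 𝒜) (hk : k ∈ X) (hkl : k ≠ l)
    (hP : P ∈ 𝒜) : split k l P ∈ 𝒜 := by
  by_contra h
  exact h (hX k hk l hkl ▸ split_mem_splitting (mem_movable.2 ⟨hP, h⟩))

theorem IsCompressedOn.isolate_mem (hX : IsCompressedOn X 𝒜) (hP : P ∈ 𝒜) :
    isolate X P ∈ 𝒜 := by
  suffices h : ∀ Y ⊆ X, isolate Y P ∈ 𝒜 from h X Subset.rfl
  intro Y
  induction Y using Finset.induction_on with
  | empty => 
    intro _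
    rwa [isolate_eq_self (empty_subset (singletons P))]
  | insert k Y _ ih =>
    intro hY
    rw [insert_subset_iff] at hY
    rw [insert_eq, ← isolate_isolate]
    by_cases hk : k ∈ singletons (isolate Y P)
    · exact (isolate_eq_self (singleton_subset_iff.2 hk)).symm ▸ ih hY.2
    · rw [mem_singletons_iff_forall] at hk
      push Not at hk
      obtain ⟨l, hl, hlk⟩ := hk
      rw [← split_eq_isolate hlk.symm hl]
      exact hX.split_mem hY.1 hlk.symm (ih hY.2)

theorem IsCompressedOn.le_card_filter_inter (hX : IsCompressedOn X 𝒜) (h𝒜 : IsIntersecting t 𝒜)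
    (hP : P ∈ 𝒜) (hQ : Q ∈ 𝒜) :
    t ≤ #{C ∈ P.parts ∩ Q.parts | 1 < #C → Disjoint C X} := by
  induction hc : #(P.parts ∩ Q.parts) using Nat.strong_induction_on generalizing P with
  | _ c ih =>
    by_cases hgood : ∀ C ∈ P.parts ∩ Q.parts, 1 < #C → Disjoint C X
    · rw [filter_true_of_mem hgood]
      exact h𝒜 P hP Q hQ
    -- Splitting `P` inside a common block that violates the condition destroys this block and
    -- creates no new common one.
    push Not at hgood
    obtain ⟨C, hC, hcard, hCX⟩ := hgood
    obtain ⟨k, hkC, hkX⟩ := not_disjoint_iff.1 hCX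
    obtain ⟨l, hlC, hlk⟩ := exists_mem_ne hcard k
    have hsub : (split k l P).parts ∩ Q.parts ⊆ (P.parts ∩ Q.parts).erase C :=
      split_inter_subset_erase hlk.symm (mem_inter.1 hC).1 (mem_inter.1 hC).2 hkC hlC
    have hlt : #((split k l P).parts ∩ Q.parts) < c :=
      hc ▸ (card_le_card hsub).trans_lt (card_erase_lt_of_mem hC)
    exact (ih _ hlt (hX.split_mem hkX hlk.symm hP) rfl).trans
      (card_le_card (filter_subset_filter _ (hsub.trans (erase_subset _ _))))

theorem mem_movable_or_mem_fixing (hT : splitting i j 𝒜 ⊆ fixing T) (hP : P ∈ 𝒜) :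
    P ∈ movable i j 𝒜 ∨ P ∈ fixing T := by
  by_cases hs : split i j P ∈ 𝒜
  · exact .inr (hT (mem_splitting.2 (.inl ⟨hP, hs⟩)))
  · exact .inl (mem_movable.2 ⟨hP, hs⟩)

theorem subset_fixing_sdiff_pair (hij : i ≠ j) (hT : splitting i j 𝒜 ⊆ fixing T) :
    𝒜 ⊆ fixing (T \ {i, j}) := by
  intro P hP
  rcases mem_movable_or_mem_fixing hT hP with hP | hP
  · have hs : T ⊆ singletons (split i j P) := mem_fixing.1 (hT (split_mem_splitting hP))
    exact mem_fixing.2 ((sdiff_subset_sdiff hs Subset.rfl).trans (singletons_split_subset hij))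
  · exact fixing_anti sdiff_subset hP

theorem mem_or_mem_of_splitting_subset (hij : i ≠ j) (hT : splitting i j 𝒜 ⊆ fixing T)
    (h𝒜 : ¬ 𝒜 ⊆ fixing T) : i ∈ T ∨ j ∈ T := by
  by_contra! h
  have hT' : T \ {i, j} = T := by simp [sdiff_insert, h]
  exact h𝒜 (hT' ▸ subset_fixing_sdiff_pair hij hT)

theorem notMem_fixing (hij : i ≠ j) (hP : j ∈ P.part i) (hiT : i ∈ T ∨ j ∈ T) :
    P ∉ fixing T := by
  rw [mem_fixing]
  intro h
  rcases hiT with hi | hj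
  · exact notMem_singletons hij hP (h hi)
  · exact notMem_singletons hij.symm (mem_part_comm.1 hP) (h hj)

theorem card_le_two_mul_card_fixing (hij : i ≠ j) (h𝒜 : ∀ P ∈ 𝒜, P ∈ fixing T ∨ j ∈ P.part i)
    (hX : 𝒜 ⊆ fixing X) (hi : i ∉ X) (hTX : ¬ T ⊆ X) (hW : #W ≤ #X + 1) :
    #𝒜 ≤ 2 * #(fixing W) := by
  have card_fixed : #{P ∈ 𝒜 | P ∈ fixing T} ≤ #(fixing W) := by
    have hlt : #X < #(T ∪ X) := card_lt_card (right_lt_sup.2 hTX)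
    refine (card_le_card fun P hP => ?_).trans
      (card_fixing_le_of_card_le (V := T ∪ X) (by omega))
    exact mem_fixing_union.2 ⟨(mem_filter.1 hP).2, hX (mem_filter.1 hP).1⟩
  have card_joined : #{P ∈ 𝒜 | P ∉ fixing T} ≤ #(fixing W) := by
    have joined (P : SetPartition n) (hP : P ∈ {P ∈ 𝒜 | P ∉ fixing T}) : j ∈ P.part i :=
      (h𝒜 P (mem_filter.1 hP).1).resolve_left (mem_filter.1 hP).2
    refine (card_le_card_of_injOn (t := fixing (insert i X)) (split i j) (fun P hP => ?_) ?_).trans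
      (card_fixing_le_of_card_le (by rwa [card_insert_of_notMem hi]))
    · exact mem_fixing.2 (insert_subset (mem_singletons_split_self hij (joined P hP))
        (mem_fixing.1 (split_mem_fixing hij (hX (mem_filter.1 hP).1))))
    · exact (split_injOn hij).mono joined
  calc #𝒜 = #{P ∈ 𝒜 | P ∈ fixing T} + #{P ∈ 𝒜 | P ∉ fixing T} :=
        (card_filter_add_card_filter_not _).symm
    _ ≤ #(fixing W) + #(fixing W) := Nat.add_le_add card_fixed card_joined
    _ = 2 * #(fixing W) := (two_mul _).symm

theorem card_le_of_isTrivial_splitting (hij : i ≠ j) (hkl : k ≠ l) (hki : k ≠ i) (hkj : k ≠ j)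
    (hiT : i ∈ T ∨ j ∈ T) (h𝒜 : ∀ P ∈ 𝒜, P ∈ fixing T ∨ j ∈ P.part i)
    (hjoined : ∃ P ∈ 𝒜, j ∈ P.part i) (htriv : IsTrivial t (splitting k l 𝒜)) (hW : #W ≤ t + 1) :
    #𝒜 ≤ 2 * #(fixing W) := by
  obtain ⟨X, rfl, hX⟩ := isTrivial_iff.1 htriv
  obtain ⟨Q, hQ, hQj⟩ : ∃ Q ∈ splitting k l 𝒜, j ∈ Q.part i :=
    exists_mem_splitting (fun _ => (mem_part_split hki hkj hkl).2) hjoined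
  have hsplit : ∀ P ∈ splitting k l 𝒜, P ∈ fixing T ∨ j ∈ P.part i :=
    forall_mem_splitting (p := fun P => P ∈ fixing T ∨ j ∈ P.part i)
      (fun P => Or.imp (split_mem_fixing hkl) (mem_part_split hki hkj hkl).2) h𝒜
  have hiX : i ∉ X := fun h => notMem_fixing hij hQj (.inl h) (hX hQ)
  have hjX : j ∉ X := fun h => notMem_fixing hij hQj (.inr h) (hX hQ)
  have hTX : ¬ T ⊆ X := fun h => hiT.elim (fun hi => hiX (h hi)) fun hj => hjX (h hj)
  exact card_splitting hkl 𝒜 ▸ card_le_two_mul_card_fixing hij hsplit hX hiX hTX hW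

theorem isCompressedOn_of_two_mul_card_fixing_lt (hij : i ≠ j)
    (hT : splitting i j 𝒜 ⊆ fixing T) (hne : splitting i j 𝒜 ≠ 𝒜) (hiT : i ∈ T ∨ j ∈ T)
    (htriv : ∀ k l, k ≠ l → splitting k l 𝒜 ≠ 𝒜 → IsTrivial t (splitting k l 𝒜))
    (hW : #W ≤ t + 1) (hlarge : 2 * #(fixing W) < #𝒜) :
    IsCompressedOn (T ∪ {i, j})ᶜ 𝒜 := by
  intro k hk l hkl
  by_contra hkl_ne
  simp only [mem_compl, mem_union, mem_insert, mem_singleton, not_or] at hk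
  obtain ⟨P, hP⟩ := splitting_ne_iff.1 hne
  have hjoined : ∃ P ∈ 𝒜, j ∈ P.part i := ⟨P, (mem_movable.1 hP).1, mem_part_of_mem_movable hP⟩
  have hT_or : ∀ P ∈ 𝒜, P ∈ fixing T ∨ j ∈ P.part i := fun P hP =>
    ((mem_movable_or_mem_fixing hT hP).imp_left mem_part_of_mem_movable).symm
  exact hlarge.not_ge <| card_le_of_isTrivial_splitting hij hkl hk.2.1 hk.2.2
    hiT hT_or hjoined (htriv k l hkl hkl_ne) hW

theorem bot_notMem (hij : i ≠ j) (hT : splitting i j 𝒜 ⊆ fixing T)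
    (hne : splitting i j 𝒜 ≠ 𝒜) (hiT : i ∈ T ∨ j ∈ T) (hX : IsCompressedOn (T ∪ {i, j})ᶜ 𝒜) :
    ⊥ ∉ 𝒜 := by
  obtain ⟨P, hP⟩ := splitting_ne_iff.1 hne
  set Q := isolate (T ∪ {i, j})ᶜ P
  have hQ : Q ∈ 𝒜 := hX.isolate_mem (mem_movable.1 hP).1
  have hQj : j ∈ Q.part i := by
    simp [Q, mem_part_isolate, mem_part_of_mem_movable hP]
  have hQ_movable : Q ∈ movable i j 𝒜 :=
    (mem_movable_or_mem_fixing hT hQ).resolve_right (notMem_fixing hij hQj hiT)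
  have compl_pair_subset : {i, j}ᶜ ⊆ singletons Q := by
    intro x hx
    by_cases hxT : x ∈ T
    · exact mem_fixing.1 (subset_fixing_sdiff_pair hij hT hQ)
        (mem_sdiff.2 ⟨hxT, mem_compl.1 hx⟩)
    · refine union_singletons_subset_singletons_isolate _ (mem_union_left _ ?_)
      rw [compl_union]
      exact mem_inter.2 ⟨mem_compl.2 hxT, hx⟩
  have hbot : split i j Q = ⊥ := eq_bot_of_compl_pair_subset_singletons
    (compl_pair_subset.trans (singletons_subset_singletons_split hij)) fun h =>
      notMem_singletons hij h (mem_singletons_split_self hij hQj)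
  exact hbot ▸ (mem_movable.1 hQ_movable).2

theorem exists_card_singletons_lt (h𝒜 : IsMaxNontrivialIntersecting t 𝒜) (hbot : ⊥ ∉ 𝒜)
    (htn : t ≤ n) : ∃ P ∈ 𝒜, #(singletons P) < t := by
  by_contra! hge
  have bot_inter (P) (hP : P ∈ insert ⊥ 𝒜) :
      t ≤ #((⊥ : SetPartition n).parts ∩ P.parts) := by
    have hsub : singletons P ⊆ singletons (⊥ : SetPartition n) :=
      (subset_univ _).trans_eq (eq_bot_iff_singletons.1 rfl).symm
    refine le_trans ?_ (card_le_card_inter_parts hsub Subset.rfl)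
    rcases mem_insert.1 hP with rfl | hP
    · simpa [eq_bot_iff_singletons.1 rfl] using htn
    · exact hge P hP
  have hinter : IsIntersecting t (insert ⊥ 𝒜) := by
    intro P hP Q hQ
    rcases mem_insert.1 hP with rfl | hP𝒜
    · exact bot_inter Q hQ
    rcases mem_insert.1 hQ with rfl | hQ𝒜
    · exact inter_comm P.parts _ ▸ bot_inter P hP
    · exact h𝒜.1.1 P hP𝒜 Q hQ𝒜
  have hnontriv : ¬ IsTrivial t (insert ⊥ 𝒜) := fun ⟨T, hT, h⟩ =>
    h𝒜.1.2 ⟨T, hT, fun P hP => h P (mem_insert_of_mem hP)⟩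
  have hle := h𝒜.2 _ ⟨hinter, hnontriv⟩
  rw [card_insert_of_notMem hbot] at hle
  omega

theorem eq_pair_or_eq_singleton {C : Finset (Fin n)} (hP : P ∈ fixing (T \ {i, j}))
    (hC : C ∈ P.parts) (hdisj : 1 < #C → Disjoint C (T ∪ {i, j})ᶜ) :
    C = {i, j} ∨ ∃ x, C = {x} := by
  refine or_iff_not_imp_right.2 fun hsing => ?_
  have hcard : 1 < #C := by
    have := card_pos.2 (P.nonempty_of_mem_parts hC)
    have := mt card_eq_one.1 hsing
    omega
  refine eq_of_subset_of_card_le (fun x hx => ?_) (card_le_two.trans hcard)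
  have hxT := disjoint_compl_right_iff.1 (hdisj hcard) hx
  by_contra hxij
  have hxP := mem_fixing.1 hP (mem_sdiff.2 ⟨(mem_union.1 hxT).resolve_right hxij, hxij⟩)
  exact hsing ⟨x, (P.part_eq_of_mem hC hx).symm.trans (mem_singletons_iff_part_eq.1 hxP)⟩

theorem IsCompressedOn.pair_mem_parts (hX : IsCompressedOn (T ∪ {i, j})ᶜ 𝒜)
    (h𝒜 : IsIntersecting t 𝒜) (hT : 𝒜 ⊆ fixing (T \ {i, j})) (hP : P ∈ 𝒜) (hQ : Q ∈ 𝒜)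
    (hQt : #(singletons Q) < t) :
    {i, j} ∈ P.parts ∧ singletons Q ⊆ singletons P ∧ #(singletons Q) + 1 = t := by
  set good := {C ∈ P.parts ∩ Q.parts | 1 < #C → Disjoint C (T ∪ {i, j})ᶜ}
  have hgood : t ≤ #good := hX.le_card_filter_inter h𝒜 hP hQ
  have hsub : good.erase {i, j} ⊆ (singletons P ∩ singletons Q).image singleton := by
    intro C hC
    obtain ⟨hne, hC⟩ := mem_erase.1 hC
    obtain ⟨hC, hdisj⟩ := mem_filter.1 hC
    obtain ⟨hCP, hCQ⟩ := mem_inter.1 hC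
    obtain ⟨x, rfl⟩ := (eq_pair_or_eq_singleton (hT hP) hCP hdisj).resolve_left hne
    exact mem_image_of_mem _ (mem_inter.2 ⟨mem_singletons.2 hCP, mem_singletons.2 hCQ⟩)
  have herase : #(good.erase {i, j}) ≤ #(singletons P ∩ singletons Q) :=
    (card_le_card hsub).trans card_image_le
  have hinter : #(singletons P ∩ singletons Q) ≤ #(singletons Q) :=
    card_le_card inter_subset_right
  have hpair : {i, j} ∈ good := by
    by_contra h
    rw [erase_eq_of_notMem h] at herase
    omega
  have hcard := card_erase_add_one hpair
  refine ⟨(mem_inter.1 (mem_filter.1 hpair).1).1, ?_, by omega⟩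
  exact inter_eq_right.1 (eq_of_subset_of_card_le inter_subset_right (by omega))

theorem IsCompressedOn.card_le_card_fixing (hij : i ≠ j) (hX : IsCompressedOn (T ∪ {i, j})ᶜ 𝒜)
    (h𝒜 : IsIntersecting t 𝒜) (hT : 𝒜 ⊆ fixing (T \ {i, j})) (hQ : Q ∈ 𝒜)
    (hQt : #(singletons Q) < t) (hW : #W ≤ t + 1) : #𝒜 ≤ #(fixing W) := by
  have part_eq {R : SetPartition n} (h : {i, j} ∈ R.parts) : R.part i = {i, j} :=
    R.part_eq_of_mem h (mem_insert_self i {j})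
  have joined {R : SetPartition n} (h : {i, j} ∈ R.parts) : j ∈ R.part i := by simp [part_eq h]
  have pair_mem (P) (hP : P ∈ 𝒜) := hX.pair_mem_parts h𝒜 hT hP hQ hQt
  obtain ⟨hQij, -, hcard⟩ := pair_mem Q hQ
  have hj : j ∉ singletons Q := notMem_singletons hij.symm (mem_part_comm.1 (joined hQij))
  have hi : i ∉ insert j (singletons Q) := by
    simpa [hij] using notMem_singletons hij (joined hQij)
  refine (card_le_card_of_injOn (t := fixing (insert i (insert j (singletons Q)))) (split i j)
    (fun P hP => ?_) ((split_injOn hij).mono fun P hP => joined (pair_mem P hP).1)).trans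
      (card_fixing_le_of_card_le ?_)
  · obtain ⟨hPij, hPQ, -⟩ := pair_mem P hP
    have hj' : j ∈ singletons (split i j P) := mem_singletons.2 <|
      (mem_parts_split hij (joined hPij)).2 <| .inr <| .inr <| by
        rw [part_eq hPij, sdiff_singleton_eq_erase, erase_insert (by simpa using hij)]
    exact mem_fixing.2 <| insert_subset (mem_singletons_split_self hij (joined hPij)) <|
      insert_subset hj' (hPQ.trans (singletons_subset_singletons_split hij))
  · rw [card_insert_of_notMem hi, card_insert_of_notMem hj]
    omega

theorem isNontrivialIntersecting_nearlyFixing (ht : 1 ≤ t) {S : Finset (Fin n)} (hS : #S = t + 2)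
    (hn : t + 3 ≤ n) : IsNontrivialIntersecting t (nearlyFixing S) := by
  refine ⟨fun P hP Q hQ => ?_, fun htriv => ?_⟩
  · obtain ⟨a, -, ha⟩ := mem_nearlyFixing.1 hP
    obtain ⟨b, -, hb⟩ := mem_nearlyFixing.1 hQ
    have hPQ := card_le_card_inter_parts (V := (S.erase a).erase b)
      ((erase_subset _ _).trans (mem_fixing.1 ha))
      (((erase_right_comm).trans_subset (erase_subset _ _)).trans (mem_fixing.1 hb))
    have := pred_card_le_card_erase (s := S) (a := a)
    have := pred_card_le_card_erase (s := S.erase a) (a := b)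
    omega
  · obtain ⟨T, rfl, hT⟩ := isTrivial_iff.1 htriv
    have subset_erase (s) (hs : s ∈ S) : T ⊆ S.erase s := by
      have hcard : 1 < #(S.erase s)ᶜ := by
        rw [card_compl, card_erase_of_mem hs, Fintype.card_fin]
        omega
      have hsing := (singletons_oneBlock hcard).trans (compl_compl _)
      exact hsing ▸ mem_fixing.1 (hT (mem_nearlyFixing.2 ⟨s, hs, mem_fixing.2 hsing.ge⟩))
    obtain ⟨x, hx⟩ := card_pos.1 ht
    obtain ⟨s, hs⟩ : S.Nonempty := card_pos.1 (by omega)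
    exact notMem_erase x S (subset_erase x (mem_of_mem_erase (subset_erase s hs hx)) hx)

end Splitting

end SetPartition

open Finset SetPartition in
theorem theorem3p6 (t : ℕ) (ht : 1 ≤ t) :
    ∃ n₀ : ℕ, ∀ n : ℕ, n₀ ≤ n → ∀ 𝒜 : Finset (SetPartition n),
      SetPartition.IsMaxNontrivialIntersecting t 𝒜 →
      ¬ SetPartition.IsCompressed 𝒜 →
      ∃ k l : Fin n, k ≠ l ∧ SetPartition.splitting k l 𝒜 ≠ 𝒜 ∧
        SetPartition.IsNontrivialIntersecting t (SetPartition.splitting k l 𝒜) := by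
  refine ⟨t + 4, fun n hn 𝒜 h𝒜 hncomp => by_contra fun hcon => ?_⟩
  push Not at hcon
  have htriv (k l : Fin n) (hkl : k ≠ l) (hne : splitting k l 𝒜 ≠ 𝒜) :
      IsTrivial t (splitting k l 𝒜) :=
    by_contra fun h => hcon k l hkl hne ⟨isIntersecting_splitting h𝒜.1.1 hkl, h⟩
  simp only [IsCompressed, not_forall] at hncomp
  obtain ⟨i, j, hij, hne⟩ := hncomp
  obtain ⟨T, hTt, hT⟩ := isTrivial_iff.1 (htriv i j hij hne)
  have hiT : i ∈ T ∨ j ∈ T := mem_or_mem_of_splitting_subset hij hT fun h =>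
    h𝒜.1.2 (isTrivial_iff.2 ⟨T, hTt, h⟩)
  obtain ⟨S, -, hS⟩ := exists_subset_card_eq (s := (univ : Finset (Fin n))) (n := t + 2)
    (by rw [card_fin]; omega)
  obtain ⟨W, -, hW⟩ := exists_subset_card_eq (s := S) (n := t + 1) (by omega)
  have hlarge : 2 * #(fixing W) < #𝒜 :=
    (two_mul_card_fixing_lt_card_nearlyFixing (S := S) (by omega) (by omega)
      (by rw [Fintype.card_fin]; omega)).trans_le
      (h𝒜.2 _ (isNontrivialIntersecting_nearlyFixing ht hS (by omega)))
  have hX := isCompressedOn_of_two_mul_card_fixing_lt hij hT hne hiT htriv hW.le hlarge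
  obtain ⟨Q, hQ, hQt⟩ := exists_card_singletons_lt h𝒜 (bot_notMem hij hT hne hiT hX) (by omega)
  have := hX.card_le_card_fixing hij h𝒜.1.1 (subset_fixing_sdiff_pair hij hT) hQ hQt hW.le
  omega
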